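/- A surface is a compact connected two-dimensional topological manifold without boundary. A triangulation $G$ of a surface $S$ is a finite simple graph embedded in $S$ such that every face (component of the complement of $G$ in $S$) is an open disk whose boundary is a $3$-cycle of $G$, where $G$ is not a single $3$-cycle embedded in the sphere. An edge of $G$ is contractible if it lies on exactly two $3$-cycles of $G$ and both of them bound faces; $G$ is irreducible if it has no contractible edge. The link of a vertex $v$ is the cycle of $G$ that is the boundary of the union of the (closed) faces containing $v$. A $3$-cycle is nonseparating if the complement in $S$ of the union of its three edges is connected. Theorem. Let $G$ be an irreducible triangulation of a surface other than the sphere, let $v$ be a vertex of $G$, and let $L$ be the link of $v$. Then there are two nonseparating $3$-cycles $v v_i v_k$ and $v v_j v_l$ of $G$ such that $v_i$, $v_j$, $v_k$, $v_l$ are distinct, one of the two paths from $v_i$ to $v_k$ in the cycle $L$ contains $v_j$, and the other path from $v_i$ to $v_k$ in $L$ contains $v_l$. -/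

import Mathlib

/-- The closed simplex spanned by the finite vertex set `s`, in barycentric coordinates. -/
def closedSimplex {V : Type*} [Fintype V] (s : Finset V) : Set (V → ℝ) :=
  {x | x ∈ stdSimplex ℝ V ∧ ∀ v, v ∉ s → x v = 0}

/-- The geometric realization of the two-dimensional simplicial complex whose vertices are the
elements of `V`, whose edges are the edges of `G`, and whose triangles are the members of
`faces`: the union of the closed simplices of the complex. -/
def complexRealization {V : Type*} [Fintype V] [DecidableEq V] (G : SimpleGraph V)
    (faces : Set (Finset V)) : Set (V → ℝ) :=
  {x | (∃ a, x ∈ closedSimplex {a}) ∨ (∃ a b, G.Adj a b ∧ x ∈ closedSimplex {a, b}) ∨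
    ∃ s ∈ faces, x ∈ closedSimplex s}

/-- A triangulation of the space `S` with (finite) vertex set `V`: a simple graph `G` on `V`
and a set of triangular faces, each bounded by a 3-cycle of `G`, together with a homeomorphism
from the resulting simplicial complex onto `S`. The homeomorphism embeds `G` in `S` so that the
components of the complement of `G` are the open triangles. -/
structure SurfaceTriangulation (S V : Type*) [TopologicalSpace S] [Fintype V]
    [DecidableEq V] where
  /-- the graph formed by the vertices and edges -/
  G : SimpleGraph V
  /-- the triangular faces, given by their sets of three vertices -/
  faces : Set (Finset V)
  /-- each face is bounded by a 3-cycle of the graph -/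
  isNClique_of_mem_faces : ∀ s ∈ faces, G.IsNClique 3 s
  /-- the homeomorphism onto the surface -/
  homeo : complexRealization G faces ≃ₜ S

namespace SurfaceTriangulation

variable {S V : Type*} [TopologicalSpace S] [Fintype V] [DecidableEq V]

/-- The edge `ab` is contractible if it is on exactly two 3-cycles of the graph and both of
them bound faces. (A 3-cycle is given by its set of three pairwise adjacent vertices.) -/
def IsContractible (T : SurfaceTriangulation S V) (a b : V) : Prop :=
  T.G.Adj a b ∧ {s : Finset V | T.G.IsNClique 3 s ∧ a ∈ s ∧ b ∈ s}.ncard = 2 ∧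
    ∀ s : Finset V, T.G.IsNClique 3 s → a ∈ s → b ∈ s → s ∈ T.faces

/-- A triangulation is irreducible if it has no contractible edge. -/
def Irreducible (T : SurfaceTriangulation S V) : Prop :=
  ∀ a b, T.G.Adj a b → ¬ T.IsContractible a b

/-- The subset of the surface formed by the three edges `ab`, `bc`, `ca`. -/
def cycleSet (T : SurfaceTriangulation S V) (a b c : V) : Set S :=
  T.homeo '' {x | x.1 ∈ closedSimplex {a, b} ∪ closedSimplex {b, c} ∪ closedSimplex {c, a}}

/-- `abc` is a 3-cycle of the graph that does not separate the surface. -/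
def IsNonseparatingThreeCycle (T : SurfaceTriangulation S V) (a b c : V) : Prop :=
  T.G.Adj a b ∧ T.G.Adj b c ∧ T.G.Adj c a ∧ IsConnected (T.cycleSet a b c)ᶜ

/-- The link of `v`: the edges `ab` opposite to `v` in the faces `vab` containing `v`. They
form the boundary of the union of the faces containing `v`. -/
def link (T : SurfaceTriangulation S V) (v : V) : SimpleGraph V where
  Adj a b := a ≠ b ∧ {v, a, b} ∈ T.faces
  symm := ⟨fun a b h => ⟨h.1.symm, by rw [Finset.pair_comm b a]; exact h.2⟩⟩
  loopless := ⟨fun _ h => h.1 rfl⟩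

/-- `p` and `q` are the two paths from `a` to `b` in the cycle graph `L`: together they form a
cycle, and this cycle contains every edge of `L`. -/
def AreTheTwoPaths {L : SimpleGraph V} {a b : V} (p q : L.Walk a b) : Prop :=
  p.IsPath ∧ q.IsPath ∧ (p.append q.reverse).IsCycle ∧
    ∀ e ∈ L.edgeSet, e ∈ p.edges ∨ e ∈ q.edges

end SurfaceTriangulation

/-! An edge of the triangulation lies on exactly two faces, so irreducibility puts every edge `va`
on a 3-cycle that bounds no face. Hence every vertex of the link cycle of `v` is the end of a chord,
an edge of `G` outside the link. Take a chord `bc` that cuts off the shortest arc. A chord from the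
vertex next to `b` on that arc must leave the arc, or it would cut off a shorter one; so it crosses
`bc` (`exists_isCycle_crossing`).

Crossing makes both 3-cycles nonseparating (`isNonseparatingThreeCycle_of_crossing`). Delete `v`,
`a`, `c` from `G`, where `ac` is one of the chords. The link of `v` falls into two arcs, which the
other chord joins. The link of `a` minus `c` is a path through `v`, so the remaining neighbors of
`a` are joined to neighbors of `v`; likewise for `c`. As `G` is connected, so is what remains. Since
`vac` bounds no face, every point off it has a positive coordinate at a remaining vertex, and the
complement in the surface is connected (`isConnected_compl_cycleSet`).

That the link is a cycle follows from local planarity by invariance of domain in the plane, which is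
proved here with continuous logarithms. -/

/-! ### Cycle graphs, arcs and crossing chords -/

namespace SimpleGraph

variable {V : Type*} {L : SimpleGraph V}

/-- A vertex has at most two neighbors in `L`, and a cycle through it already uses both. -/
theorem IsCycles.mem_edges_of_isCycle [Finite V] (h : L.IsCycles) {a : V} {p : L.Walk a a}
    (hp : p.IsCycle) {x y : V} (hx : x ∈ p.support) (hxy : L.Adj x y) : s(x, y) ∈ p.edges := by
  classical
  have := Fintype.ofFinite V
  have : L.LocallyFinite := fun _ => Fintype.ofFinite _
  have := (hp.adj_toSubgraph_iff_of_isCycles h (v := x) (by simpa using hx) y).mpr hxy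
  exact p.adj_toSubgraph_iff_mem_edges.mp this

theorem IsCycles.exists_isCycle_forall_mem_support [Finite V] (h : L.IsCycles)
    (hconn : ∀ a b, a ∈ L.support → b ∈ L.support → L.Reachable a b) {a : V} (ha : a ∈ L.support) :
    ∃ p : L.Walk a a, p.IsCycle ∧ ∀ w ∈ L.support, w ∈ p.support := by
  obtain ⟨p, hp, hs⟩ := h.exists_cycle_toSubgraph_verts_eq_connectedComponentSupp
    (c := L.connectedComponentMk a) (v := a) rfl ha
  refine ⟨p, hp, fun w hw => ?_⟩
  rw [← Walk.mem_verts_toSubgraph, hs]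
  exact ConnectedComponent.sound (hconn w a hw ha)

/-- Connectedness after deleting vertices is expressed throughout by equivalence relations that
contain the surviving edges. Such a relation can be pulled back along a map of vertices, which is
used for the links of `a` and `c`. -/
theorem Walk.rel_getVert_of_forall_adj {a b : V} (p : L.Walk a b) {r : V → V → Prop}
    (hr : Equivalence r) {i j : ℕ} (hij : i ≤ j) (hj : j ≤ p.length)
    (h : ∀ m, i ≤ m → m < j → L.Adj (p.getVert m) (p.getVert (m + 1)) →
      r (p.getVert m) (p.getVert (m + 1))) : r (p.getVert i) (p.getVert j) := by
  induction j, hij using Nat.le_induction with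
  | base => exact hr.refl _
  | succ j hij ih =>
    exact hr.trans (ih (by omega) fun m hm hm' => h m hm (by omega))
      (h j hij (by omega) (p.adj_getVert_succ (by omega)))

theorem Walk.IsCycle.getVert_ne_getVert {a : V} {p : L.Walk a a} (hp : p.IsCycle) {i j : ℕ}
    (hij : i < j) (hj : j < p.length) : p.getVert i ≠ p.getVert j := fun e => by
  have := hp.getVert_injOn' (show i ≤ p.length - 1 by omega) (show j ≤ p.length - 1 by omega) e
  omega

/-- Deleting a vertex does not disconnect a cycle. -/
theorem Walk.IsCycle.rel_of_forall_adj_ne {c : V} {p : L.Walk c c} (hp : p.IsCycle)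
    {r : V → V → Prop} (hr : Equivalence r)
    (h : ∀ x y, L.Adj x y → x ≠ c → y ≠ c → r x y) {x y : V} (hx : x ∈ p.support) (hxc : x ≠ c)
    (hy : y ∈ p.support) (hyc : y ≠ c) : r x y := by
  have key : ∀ z ∈ p.support, z ≠ c → r (p.getVert 1) z := by
    intro z hz hzc
    obtain ⟨i, rfl, hi⟩ := Walk.mem_support_iff_exists_getVert.mp hz
    have hi0 : i ≠ 0 := by rintro rfl; simp at hzc
    have hin : i ≠ p.length := by rintro rfl; simp at hzc
    refine p.rel_getVert_of_forall_adj hr (by omega) hi fun m hm hm' hadj => h _ _ hadj ?_ ?_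
    · have := hp.getVert_ne_getVert (i := 0) (j := m) (by omega) (by omega)
      simpa using this.symm
    · have := hp.getVert_ne_getVert (i := 0) (j := m + 1) (by omega) (by omega)
      simpa using this.symm
  exact hr.trans (hr.symm (key x hx hxc)) (key y hy hyc)

/-- The two arcs of a cycle between the ends of a chord are joined by a crossing chord. -/
theorem Walk.IsCycle.rel_of_forall_adj_of_rel {a : V} {p : L.Walk a a} (hp : p.IsCycle)
    {r : V → V → Prop} (hr : Equivalence r) {i k j : ℕ} (hi : 0 < i) (hik : i < k) (hkj : k < j)
    (hj : j < p.length) (hij : r (p.getVert i) (p.getVert j))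
    (h : ∀ x y, L.Adj x y → x ≠ a → x ≠ p.getVert k → y ≠ a → y ≠ p.getVert k → r x y)
    {x y : V} (hx : x ∈ p.support) (hxa : x ≠ a) (hxk : x ≠ p.getVert k)
    (hy : y ∈ p.support) (hya : y ≠ a) (hyk : y ≠ p.getVert k) : r x y := by
  have hne : ∀ m, 0 < m → m < p.length → p.getVert m ≠ a := fun m h1 h2 => by
    simpa using (hp.getVert_ne_getVert h1 h2).symm
  have hnk : ∀ m, m ≠ k → m < p.length → p.getVert m ≠ p.getVert k := fun m h1 h2 => by
    rcases lt_or_gt_of_ne h1 with h1 | h1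
    · exact hp.getVert_ne_getVert h1 (by omega)
    · exact (hp.getVert_ne_getVert h1 h2).symm
  -- Movement within one arc; `hij` gives the passage to the other.
  have step : ∀ s t, 0 < s → s ≤ t → t < p.length → (t < k ∨ k < s) →
      r (p.getVert s) (p.getVert t) := fun s t h1 h2 h3 h4 =>
    p.rel_getVert_of_forall_adj hr h2 h3.le fun m hm hm' hadj =>
      h _ _ hadj (hne _ (by omega) (by omega)) (hnk _ (by omega) (by omega))
        (hne _ (by omega) (by omega)) (hnk _ (by omega) (by omega))
  have key : ∀ z ∈ p.support, z ≠ a → z ≠ p.getVert k → r (p.getVert i) z := by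
    intro z hz hza hzk
    obtain ⟨m, rfl, hm⟩ := Walk.mem_support_iff_exists_getVert.mp hz
    have hm0 : m ≠ 0 := by rintro rfl; simp at hza
    have hmn : m ≠ p.length := by rintro rfl; simp at hza
    have hmk : m ≠ k := by rintro rfl; simp at hzk
    rcases lt_or_gt_of_ne hmk with hlt | hgt
    · rcases le_total i m with h1 | h1
      · exact step i m hi h1 (by omega) (.inl hlt)
      · exact hr.symm (step m i (by omega) h1 (by omega) (.inl hik))
    · refine hr.trans hij ?_
      rcases le_total j m with h1 | h1
      · exact step j m (by omega) h1 (by omega) (.inr hkj)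
      · exact hr.symm (step m j (by omega) h1 (by omega) (.inr hgt))
  exact hr.trans (hr.symm (key x hx hxa hxk)) (key y hy hya hyk)

/-- The cycle `p` with its starting point moved one step along. -/
theorem Walk.IsCycle.exists_isCycle_getVert_succ [DecidableEq V] {a : V} {p : L.Walk a a}
    (hp : p.IsCycle) :
    ∃ q : L.Walk (p.getVert 1) (p.getVert 1), q.IsCycle ∧ q.length = p.length ∧
      (∀ i < p.length, q.getVert i = p.getVert (i + 1)) ∧ ∀ w, w ∈ q.support ↔ w ∈ p.support := by
  cases p with
  | nil => exact absurd rfl hp.ne_nil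
  | @cons _ b _ h t =>
    have hb : (cons h t).getVert 1 = b := by simp
    rw [hb]
    obtain ⟨ht, he⟩ := (cons_isCycle_iff t h).mp hp
    have hcyc : (t.concat h).IsCycle := by
      rw [← isCycle_reverse, reverse_concat, cons_isCycle_iff]
      exact ⟨ht.reverse, by simpa [Sym2.eq_swap] using he⟩
    have hgv : ∀ i < (cons h t).length, (t.concat h).getVert i = (cons h t).getVert (i + 1) := by
      intro i hi
      rw [getVert_cons_succ, concat_eq_append, getVert_append]
      split_ifs with hlt
      · rfl
      · have : i = t.length := by simp at hi; omega
        subst this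
        simp
    refine ⟨t.concat h, hcyc, by simp, hgv, fun w => ?_⟩
    have hbm : b ∈ t.support := t.start_mem_support
    have ham : a ∈ t.support := t.end_mem_support
    rw [support_concat, support_cons, List.mem_append, List.mem_singleton,
      List.mem_cons]
    constructor
    · rintro (h | rfl)
      · exact .inr h
      · exact .inr hbm
    · rintro (rfl | h)
      · exact .inl ham
      · exact .inl h

/-- If every vertex of a cycle is the end of a chord, then two chords cross. -/
theorem exists_isCycle_crossing [DecidableEq V] {H : SimpleGraph V} {a : V} (p : L.Walk a a)
    (hp : p.IsCycle) (hch : ∀ x ∈ p.support, ∃ y ∈ p.support, H.Adj x y ∧ ¬ L.Adj x y) :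
    ∃ (b : V) (q : L.Walk b b) (k m : ℕ), q.IsCycle ∧ (∀ w, w ∈ q.support ↔ w ∈ p.support) ∧
      1 < k ∧ k < m ∧ m < q.length ∧
      (H.Adj b (q.getVert k) ∧ ¬ L.Adj b (q.getVert k)) ∧
      H.Adj (q.getVert 1) (q.getVert m) ∧ ¬ L.Adj (q.getVert 1) (q.getVert m) := by
  have hidx : ∀ (b : V) (q : L.Walk b b), q.IsCycle → (∀ w, w ∈ q.support ↔ w ∈ p.support) →
      ∀ x ∈ q.support, ∃ m < q.length, H.Adj x (q.getVert m) ∧ ¬ L.Adj x (q.getVert m) := by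
    intro b q hq hs x hx
    obtain ⟨y, hy, h⟩ := hch x ((hs x).mp hx)
    obtain ⟨m, rfl, hm⟩ := Walk.mem_support_iff_exists_getVert.mp ((hs y).mpr hy)
    have hq3 := hq.three_le_length
    rcases hm.lt_or_eq with hlt | rfl
    · exact ⟨m, hlt, h⟩
    · exact ⟨0, by omega, by simpa using h⟩
  have hex : ∃ k, ∃ (b : V) (q : L.Walk b b), q.IsCycle ∧ (∀ w, w ∈ q.support ↔ w ∈ p.support) ∧
      k < q.length ∧ H.Adj b (q.getVert k) ∧ ¬ L.Adj b (q.getVert k) := by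
    obtain ⟨m, hm, h⟩ := hidx a p hp (fun _ => Iff.rfl) a p.start_mem_support
    exact ⟨m, a, p, hp, fun _ => Iff.rfl, hm, h⟩
  classical
  -- A shortest chord, minimal over all cycles on this vertex set and all their starting points.
  obtain ⟨b, q, hq, hs, hk, hH, hL⟩ := Nat.find_spec hex
  have hmin := fun k => Nat.find_min hex (m := k)
  generalize Nat.find hex = k at hk hH hL hmin
  have hk0 : k ≠ 0 := by rintro rfl; simp at hH
  have hk1 : k ≠ 1 := by
    rintro rfl
    exact hL (by simpa using q.adj_getVert_succ (i := 0) (by omega))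
  obtain ⟨m, hm, hH', hL'⟩ := hidx b q hq hs (q.getVert 1) (q.getVert_mem_support 1)
  have hm0 : m ≠ 0 := by
    rintro rfl
    exact hL' (by simpa using (q.adj_getVert_succ (i := 0) (by omega)).symm)
  have hm1 : m ≠ 1 := by rintro rfl; simp at hH'
  refine ⟨b, q, k, m, hq, hs, by omega, ?_, hm, ⟨hH, hL⟩, hH', hL'⟩
  by_contra hmk
  -- If `m ≤ k`, the chord from position 1 has length `m - 1 < k` once the cycle starts there.
  obtain ⟨q', hq', hlen, hgv, hs'⟩ := hq.exists_isCycle_getVert_succ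
  refine hmin (m - 1) (by omega) ⟨_, q', hq', fun w => (hs' w).trans (hs w), by omega, ?_⟩
  rw [hgv _ (by omega), Nat.sub_add_cancel (by omega)]
  exact ⟨hH', hL'⟩

end SimpleGraph

/-! ### Invariance of domain in the plane -/

open Topology unitInterval in
-- A logarithm is a lift through the covering `exp` of the punctured plane, so the homotopy lifts
-- from its start.
theorem exists_continuous_log_of_homotopy {A : Type*} [TopologicalSpace A] (H : C(I × A, ℂ))
    (hH : ∀ x, H x ≠ 0) (f : C(A, ℂ)) (hf : ∀ a, Complex.exp (f a) = H (0, a)) :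
    ∃ g : C(A, ℂ), ∀ a, Complex.exp (g a) = H (1, a) := by
  let H' : C(I × A, {z : ℂ // z ≠ 0}) := ⟨fun x => ⟨H x, hH x⟩, by fun_prop⟩
  have h0 : ∀ a, H' (0, a) = ⟨Complex.exp (f a), Complex.exp_ne_zero _⟩ :=
    fun a => Subtype.ext (hf a).symm
  let F := Complex.isCoveringMap_exp.liftHomotopy H' f h0
  refine ⟨F.comp ⟨fun a => (1, a), by fun_prop⟩, fun a => ?_⟩
  have := congrFun (Complex.isCoveringMap_exp.liftHomotopy_lifts H' f h0) (1, a)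
  exact congrArg Subtype.val this

/-- An odd nonvanishing function on the unit circle has no continuous logarithm. -/
theorem not_exists_continuous_log_of_odd (g : C(Metric.sphere (0 : ℂ) 1, ℂ))
    (hg : ∀ a, Complex.exp (g (-a)) = -Complex.exp (g a)) : False := by
  have hconn : PreconnectedSpace (Metric.sphere (0 : ℂ) 1) := by
    apply isPreconnected_iff_preconnectedSpace.mp
    exact isPreconnected_sphere (by rw [Complex.rank_real_complex]; norm_num) 0 1
  -- `g (-a) - g a` is an odd multiple of `πi`, constant by connectedness, yet it changes sign under
  -- `a ↦ -a`.
  have hk : ∀ a, ∃ k : ℤ, g (-a) - g a = Real.pi * Complex.I + k * (2 * Real.pi * Complex.I) := by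
    intro a
    have h1 : Complex.exp (g (-a)) = Complex.exp (g a + Real.pi * Complex.I) := by
      rw [hg, Complex.exp_add, Complex.exp_pi_mul_I]; ring
    obtain ⟨k, hk⟩ := Complex.exp_eq_exp_iff_exists_int.mp h1
    exact ⟨k, by rw [hk]; ring⟩
  choose k hk using hk
  have hc : Continuous fun a => ((k a : ℤ) : ℝ) := by
    have h2 : (fun a => ((k a : ℤ) : ℝ)) =
        fun a => ((g (-a) - g a).im - Real.pi) / (2 * Real.pi) := by
      funext a
      rw [hk a]
      simp
    rw [h2]
    fun_prop
  have hc' : Continuous k := Int.isClosedEmbedding_coe_real.isInducing.continuous_iff.mpr hc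
  obtain ⟨a⟩ : Nonempty (Metric.sphere (0 : ℂ) 1) := ⟨⟨1, by simp⟩⟩
  have e : k (-a) = k a := PreconnectedSpace.constant hconn hc'
  have h1 := hk a
  have h2 := hk (-a)
  rw [neg_neg, e] at h2
  have h3 : (2 * (k a : ℂ) + 1) * (2 * (Real.pi * Complex.I)) = 0 := by
    linear_combination -h1 - h2
  rcases mul_eq_zero.mp h3 with h | h
  · have : (2 * k a + 1 : ℤ) = 0 := by exact_mod_cast h
    omega
  · simp [Real.pi_ne_zero] at h

open Metric Topology unitInterval in
-- If the image missed a point `p` near `f 0`, three nonvanishing homotopies on the circle would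
-- carry a constant to an odd function, giving the latter a continuous logarithm.
theorem image_closedBall_mem_nhds_of_injOn {f : ℂ → ℂ} (hc : ContinuousOn f (closedBall 0 1))
    (hi : Set.InjOn f (closedBall 0 1)) : f '' closedBall 0 1 ∈ 𝓝 (f 0) := by
  have h0 : (0 : ℂ) ∈ closedBall (0 : ℂ) 1 := by simp
  have hcl : IsClosed (f '' sphere (0 : ℂ) 1) :=
    ((isCompact_sphere _ _).image_of_continuousOn (hc.mono sphere_subset_closedBall)).isClosed
  have hn : f 0 ∉ f '' sphere (0 : ℂ) 1 := by
    rintro ⟨z, hz, e⟩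
    have := hi (sphere_subset_closedBall hz) h0 e
    simp [this] at hz
  obtain ⟨ε, hε, hball⟩ := Metric.isOpen_iff.mp hcl.isOpen_compl (f 0) hn
  refine Filter.mem_of_superset (ball_mem_nhds _ hε) fun p hp => ?_
  by_contra hpn
  have hz1 : ∀ z : sphere (0 : ℂ) 1, ‖(z : ℂ)‖ = 1 := fun z => by simp
  -- From the constant `f 0 - p` to `f z - p`, by growing the radius.
  obtain ⟨g₁, hg₁⟩ := exists_continuous_log_of_homotopy (A := sphere (0 : ℂ) 1)
    ⟨fun x => f ((x.1 : ℝ) * (x.2 : ℂ)) - p, by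
      refine Continuous.sub (hc.comp_continuous (by fun_prop) fun x => ?_) continuous_const
      simp [hz1, abs_of_nonneg x.1.2.1, x.1.2.2]⟩
    (fun x => by
      refine sub_ne_zero.mpr fun e => hpn ⟨_, ?_, e⟩
      simp [hz1, abs_of_nonneg x.1.2.1, x.1.2.2])
    (ContinuousMap.const _ (Complex.log (f 0 - p)))
    (fun a => by
      simp only [ContinuousMap.const_apply, ContinuousMap.coe_mk, Set.Icc.coe_zero,
        Complex.ofReal_zero, zero_mul]
      exact Complex.exp_log (sub_ne_zero.mpr fun e => hpn ⟨0, h0, e⟩))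
  -- From `f z - p` to `f z - f 0`: the segment from `p` to `f 0` stays in a ball that misses the
  -- image of the circle.
  obtain ⟨g₂, hg₂⟩ := exists_continuous_log_of_homotopy (A := sphere (0 : ℂ) 1)
    ⟨fun x => f (x.2 : ℂ) - (p + ((x.1 : ℝ) : ℂ) * (f 0 - p)), by
      refine Continuous.sub (hc.comp_continuous (by fun_prop) fun x => ?_) (by fun_prop)
      simp [hz1]⟩
    (fun x => by
      refine sub_ne_zero.mpr fun e => ?_
      refine hball (?_ : f (x.2 : ℂ) ∈ _) ⟨_, x.2.2, rfl⟩
      rw [e]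
      have := (convex_ball (f 0) ε).add_smul_sub_mem hp (mem_ball_self hε) x.1.2
      simpa using this)
    g₁ (fun a => by simpa using hg₁ a)
  -- From `f z - f 0` to the odd function `f (z/2) - f (-z/2)`. The two arguments always differ by
  -- exactly `z`, so injectivity prevents a zero.
  obtain ⟨g₃, hg₃⟩ := exists_continuous_log_of_homotopy (A := sphere (0 : ℂ) 1)
    ⟨fun x => f (((1 / (1 + (x.1 : ℝ)) : ℝ) : ℂ) * (x.2 : ℂ)) -
        f (((-(x.1 : ℝ) / (1 + (x.1 : ℝ)) : ℝ) : ℂ) * (x.2 : ℂ)), by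
      have hp : ∀ x : I × sphere (0 : ℂ) 1, 1 + (x.1 : ℝ) ≠ 0 := fun x => by
        linarith [x.1.2.1]
      refine Continuous.sub (hc.comp_continuous (by fun_prop (disch := exact hp)) fun x => ?_)
        (hc.comp_continuous (by fun_prop (disch := exact hp)) fun x => ?_)
      all_goals
        have h1 := x.1.2.1
        have h2 : |1 + (x.1 : ℝ)| = 1 + x.1 := abs_of_nonneg (by linarith)
        rw [mem_closedBall_zero_iff, norm_mul, hz1, mul_one, Complex.norm_real, Real.norm_eq_abs,
          abs_div, h2, div_le_one (by linarith)]
      · simpa using h1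
      · rw [abs_neg, abs_of_nonneg h1]; linarith⟩
    (fun x => by
      have h1 := x.1.2.1
      have h2 : |1 + (x.1 : ℝ)| = 1 + x.1 := abs_of_nonneg (by linarith)
      refine sub_ne_zero.mpr fun e => ?_
      have e' := hi ?_ ?_ e
      · have hx0 : (x.2 : ℂ) ≠ 0 := fun h => by simpa [h] using hz1 x.2
        have e'' := mul_right_cancel₀ hx0 e'
        have e3 : 1 / (1 + (x.1 : ℝ)) = -(x.1 : ℝ) / (1 + (x.1 : ℝ)) := by exact_mod_cast e''
        rw [div_left_inj' (by linarith)] at e3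
        linarith
      all_goals
        rw [mem_closedBall_zero_iff, norm_mul, hz1, mul_one, Complex.norm_real, Real.norm_eq_abs,
          abs_div, h2, div_le_one (by linarith)]
      · simpa using h1
      · rw [abs_neg, abs_of_nonneg h1]; linarith)
    g₂ (fun a => by simpa using hg₂ a)
  refine not_exists_continuous_log_of_odd g₃ fun a => ?_
  rw [hg₃, hg₃]
  simp only [ContinuousMap.coe_mk, Set.Icc.coe_one]
  norm_num

open Topology in
/-- Invariance of domain in the plane. -/
theorem image_mem_nhds_of_continuousOn_of_injOn {f : ℂ → ℂ} {U : Set ℂ} {x : ℂ} (hU : U ∈ 𝓝 x)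
    (hc : ContinuousOn f U) (hi : Set.InjOn f U) : f '' U ∈ 𝓝 (f x) := by
  obtain ⟨ε, hε, hsub⟩ := Metric.nhds_basis_closedBall.mem_iff.mp hU
  have hmem : ∀ z ∈ Metric.closedBall (0 : ℂ) 1, x + ε * z ∈ U := fun z hz => by
    apply hsub
    rw [mem_closedBall_zero_iff] at hz
    rw [mem_closedBall_iff_norm]
    simp [abs_of_pos hε]
    nlinarith
  have hε' : (ε : ℂ) ≠ 0 := by exact_mod_cast hε.ne'
  have := image_closedBall_mem_nhds_of_injOn (f := fun z => f (x + ε * z))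
    (hc.comp (by fun_prop) hmem)
    (fun z hz w hw e => by
      have := hi (hmem z hz) (hmem w hw) e
      exact mul_left_cancel₀ hε' (add_left_cancel this))
  simp only [mul_zero, add_zero] at this
  refine Filter.mem_of_superset this ?_
  rintro _ ⟨z, hz, rfl⟩
  exact ⟨_, hmem z hz, rfl⟩

open Metric Topology in
theorem Complex.isConnected_ball_diff_center (c : ℂ) {r : ℝ} (hr : 0 < r) :
    IsConnected (ball c r \ {c}) := by
  have h1 : IsConnected (sphere (0 : ℂ) 1) :=
    isConnected_sphere (by rw [Complex.rank_real_complex]; norm_num) 0 zero_le_one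
  have h2 := (isConnected_Ioo hr).prod h1
  have h3 := h2.image (fun x : ℝ × ℂ => c + x.1 * x.2) (by fun_prop)
  convert h3 using 1
  ext z
  constructor
  · rintro ⟨hz, hzc⟩
    have hne : z - c ≠ 0 := sub_ne_zero.mpr hzc
    refine ⟨(‖z - c‖, (z - c) / ‖z - c‖), ⟨⟨norm_pos_iff.mpr hne, by simpa [dist_eq_norm] using hz⟩,
      ?_⟩, ?_⟩
    · simp [hne]
    · have : (‖z - c‖ : ℂ) ≠ 0 := by simpa using hne
      simp only
      rw [mul_div_cancel₀ _ this]
      ring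
  · rintro ⟨⟨t, w⟩, ⟨⟨ht0, htr⟩, hw⟩, rfl⟩
    have hw' : ‖w‖ = 1 := by simpa using hw
    have hw0 : w ≠ 0 := by rintro rfl; simp at hw'
    simp at ht0 htr
    simp [hw', abs_of_pos ht0, htr, ht0.ne', hw0]

open Topology

/-! ### Locally planar spaces and subspaces -/

section Planar

variable {X : Type*} [TopologicalSpace X]

theorem image_mem_nhds_of_openPartialHomeomorph_target {φ : ℂ → X} {U : Set ℂ} {z : ℂ}
    (E : OpenPartialHomeomorph X ℂ) (hE : φ z ∈ E.source) (hU : U ∈ 𝓝 z) (hc : ContinuousOn φ U)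
    (hi : Set.InjOn φ U) : φ '' U ∈ 𝓝 (φ z) := by
  have hU' : U ∩ φ ⁻¹' E.source ∈ 𝓝 z :=
    Filter.inter_mem hU ((hc.continuousAt hU) (E.open_source.mem_nhds hE))
  have key := image_mem_nhds_of_continuousOn_of_injOn (f := E ∘ φ) hU'
    (E.continuousOn.comp (hc.mono Set.inter_subset_left) fun w hw => hw.2)
    (E.injOn.comp (hi.mono Set.inter_subset_left) fun w hw => hw.2)
  have h1 : E ⁻¹' ((E ∘ φ) '' (U ∩ φ ⁻¹' E.source)) ∈ 𝓝 (φ z) :=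
    (E.continuousAt hE) key
  filter_upwards [h1, E.open_source.mem_nhds hE] with y hy hyE
  obtain ⟨w, hw, e⟩ := hy
  exact ⟨w, hw.1, E.injOn hw.2 hyE e⟩

theorem image_mem_nhds_of_openPartialHomeomorph_source {ψ : X → ℂ} {N : Set X} {x : X}
    (E : OpenPartialHomeomorph X ℂ) (hE : x ∈ E.source) (hN : N ∈ 𝓝 x) (hc : ContinuousOn ψ N)
    (hi : Set.InjOn ψ N) : ψ '' N ∈ 𝓝 (ψ x) := by
  have ht : E x ∈ E.target := E.map_source hE
  have hU : E.target ∩ E.symm ⁻¹' N ∈ 𝓝 (E x) := by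
    refine Filter.inter_mem (E.open_target.mem_nhds ht) ((E.continuousAt_symm ht) ?_)
    rwa [E.left_inv hE]
  have key := image_mem_nhds_of_continuousOn_of_injOn (f := ψ ∘ E.symm) hU
    (hc.comp (E.continuousOn_symm.mono Set.inter_subset_left) fun w hw => hw.2)
    (hi.comp (E.symm.injOn.mono Set.inter_subset_left) fun w hw => hw.2)
  rw [Function.comp_apply, E.left_inv hE] at key
  refine Filter.mem_of_superset key ?_
  rintro _ ⟨w, hw, rfl⟩
  exact ⟨_, hw.2, rfl⟩

theorem exists_mem_nhds_isConnected_diff_singleton {N : Set X} {x : X}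
    (E : OpenPartialHomeomorph X ℂ) (hE : x ∈ E.source) (hN : N ∈ 𝓝 x) :
    ∃ W ∈ 𝓝 x, W ⊆ N ∧ IsConnected (W \ {x}) := by
  have ht : E x ∈ E.target := E.map_source hE
  have hU : E.target ∩ E.symm ⁻¹' N ∈ 𝓝 (E x) := by
    refine Filter.inter_mem (E.open_target.mem_nhds ht) ((E.continuousAt_symm ht) ?_)
    rwa [E.left_inv hE]
  obtain ⟨r, hr, hsub⟩ := Metric.mem_nhds_iff.mp hU
  have hW : E.symm '' Metric.ball (E x) r ∈ 𝓝 x := by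
    have h1 := E.symm.image_mem_nhds (x := E x) ht (Metric.ball_mem_nhds _ hr)
    rwa [E.left_inv hE] at h1
  refine ⟨_, hW, ?_, ?_⟩
  · rintro _ ⟨w, hw, rfl⟩
    exact (hsub hw).2
  · have h1 := (Complex.isConnected_ball_diff_center (E x) hr).image E.symm
      (E.continuousOn_symm.mono fun w hw => (hsub hw.1).1)
    convert h1 using 1
    ext y
    constructor
    · rintro ⟨⟨w, hw, rfl⟩, hy⟩
      refine ⟨w, ⟨hw, fun h => hy ?_⟩, rfl⟩
      rw [Set.mem_singleton_iff.mp h, E.left_inv hE]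
      rfl
    · rintro ⟨w, ⟨hw, hwx⟩, rfl⟩
      refine ⟨⟨w, hw, rfl⟩, fun h => hwx ?_⟩
      rw [Set.mem_singleton_iff] at h ⊢
      rw [← h, E.right_inv (hsub hw).1]

end Planar

section Subspace

variable {Y : Type*} [TopologicalSpace Y] {K : Set Y}

/-- The realization is a subset of `V → ℝ`, so the local statements are restated relative to an
ambient space. -/
theorem image_mem_nhdsWithin_of_planar (hK : ∀ x : K, ∃ E : OpenPartialHomeomorph K ℂ, x ∈ E.source)
    {φ : ℂ → Y} {U : Set ℂ} {z : ℂ} (hU : U ∈ 𝓝 z) (hm : Set.MapsTo φ U K)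
    (hc : ContinuousOn φ U) (hi : Set.InjOn φ U) : φ '' U ∈ 𝓝[K] (φ z) := by
  classical
  have hz := hm (mem_of_mem_nhds hU)
  let φ' : ℂ → K := fun w => if h : φ w ∈ K then ⟨φ w, h⟩ else ⟨φ z, hz⟩
  have hφ : ∀ w, φ w ∈ K → (φ' w : Y) = φ w := fun w hw => by simp [φ', hw]
  obtain ⟨E, hE⟩ := hK (φ' z)
  have key := image_mem_nhds_of_openPartialHomeomorph_target E hE hU
    (IsInducing.subtypeVal.continuousOn_iff.mpr (hc.congr fun w hw => hφ w (hm hw)))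
    (fun w hw w' hw' e => hi hw hw' (by rw [← hφ w (hm hw), ← hφ w' (hm hw'), e]))
  rw [show φ z = ((φ' z : K) : Y) from (hφ z hz).symm, ← map_nhds_subtype_val, Filter.mem_map]
  filter_upwards [key] with y hy
  obtain ⟨w, hw, rfl⟩ := hy
  exact ⟨w, hw, (hφ w (hm hw)).symm⟩

theorem image_inter_mem_nhds_of_planar
    (hK : ∀ x : K, ∃ E : OpenPartialHomeomorph K ℂ, x ∈ E.source)
    {ψ : Y → ℂ} {N : Set Y} {x : Y} (hx : x ∈ K) (hN : N ∈ 𝓝 x) (hc : ContinuousOn ψ (N ∩ K))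
    (hi : Set.InjOn ψ (N ∩ K)) : ψ '' (N ∩ K) ∈ 𝓝 (ψ x) := by
  obtain ⟨E, hE⟩ := hK ⟨x, hx⟩
  have key := image_mem_nhds_of_openPartialHomeomorph_source (ψ := fun y : K => ψ y) E hE
    (continuousAt_subtype_val hN)
    (hc.comp continuous_subtype_val.continuousOn fun y hy => ⟨hy, y.2⟩)
    (fun y hy y' hy' e => Subtype.ext (hi ⟨hy, y.2⟩ ⟨hy', y'.2⟩ e))
  refine Filter.mem_of_superset key ?_
  rintro _ ⟨y, hy, rfl⟩
  exact ⟨y, ⟨hy, y.2⟩, rfl⟩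

theorem exists_mem_nhdsWithin_isConnected_diff_singleton
    (hK : ∀ x : K, ∃ E : OpenPartialHomeomorph K ℂ, x ∈ E.source)
    {N : Set Y} {x : Y} (hx : x ∈ K) (hN : N ∈ 𝓝 x) :
    ∃ W ∈ 𝓝[K] x, W ⊆ N ∩ K ∧ IsConnected (W \ {x}) := by
  obtain ⟨E, hE⟩ := hK ⟨x, hx⟩
  obtain ⟨W, hW, hWN, hcon⟩ := exists_mem_nhds_isConnected_diff_singleton E hE
    (continuousAt_subtype_val hN)
  refine ⟨Subtype.val '' W, ?_, ?_, ?_⟩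
  · rw [show x = ((⟨x, hx⟩ : K) : Y) from rfl, ← map_nhds_subtype_val]
    exact Filter.image_mem_map hW
  · rintro _ ⟨y, hy, rfl⟩
    exact ⟨hWN hy, y.2⟩
  · convert hcon.image Subtype.val continuous_subtype_val.continuousOn using 1
    rw [Set.image_sdiff Subtype.val_injective, Set.image_singleton]

end Subspace

/-! ### Local structure of the complex at edges and vertices -/

section Realization

variable {V : Type*} [Fintype V] [DecidableEq V] {G : SimpleGraph V} {faces : Set (Finset V)}

/-- Treats the three kinds of simplex at once: only the support of a point matters afterwards. -/
theorem exists_clique_of_mem_complexRealization (hf : ∀ s ∈ faces, G.IsNClique 3 s) {z : V → ℝ}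
    (hz : z ∈ complexRealization G faces) : z ∈ stdSimplex ℝ V ∧ ∃ s : Finset V,
      G.IsClique s ∧ (s.card ≤ 2 ∨ s ∈ faces) ∧ ∀ c, z c ≠ 0 → c ∈ s := by
  rcases hz with ⟨a, h, hs⟩ | ⟨a, b, hab, h, hs⟩ | ⟨s, hsf, h, hs⟩
  · exact ⟨h, {a}, by simp, .inl (by simp), fun c => not_imp_comm.mp (hs c)⟩
  · refine ⟨h, {a, b}, ?_, .inl Finset.card_le_two, fun c => not_imp_comm.mp (hs c)⟩
    simpa [SimpleGraph.isClique_pair] using fun _ => hab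
  · exact ⟨h, s, (hf s hsf).isClique, .inr hsf, fun c => not_imp_comm.mp (hs c)⟩

theorem adj_of_mem_complexRealization (hf : ∀ s ∈ faces, G.IsNClique 3 s) {z : V → ℝ}
    (hz : z ∈ complexRealization G faces) {a b : V} (hab : a ≠ b) (ha : z a ≠ 0) (hb : z b ≠ 0) :
    G.Adj a b := by
  obtain ⟨-, s, hs, -, h⟩ := exists_clique_of_mem_complexRealization hf hz
  exact hs (h a ha) (h b hb) hab

theorem mem_faces_of_mem_complexRealization (hf : ∀ s ∈ faces, G.IsNClique 3 s) {z : V → ℝ}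
    (hz : z ∈ complexRealization G faces) {a b c : V} (hab : a ≠ b) (hac : a ≠ c) (hbc : b ≠ c)
    (ha : z a ≠ 0) (hb : z b ≠ 0) (hc : z c ≠ 0) : {a, b, c} ∈ faces := by
  obtain ⟨-, s, hs, hcard, h⟩ := exists_clique_of_mem_complexRealization hf hz
  have hsub : {a, b, c} ⊆ s := by
    intro x hx
    simp only [Finset.mem_insert, Finset.mem_singleton] at hx
    rcases hx with rfl | rfl | rfl
    exacts [h _ ha, h _ hb, h _ hc]
  have h3 : ({a, b, c} : Finset V).card = 3 := Finset.card_eq_three.mpr ⟨a, b, c, hab, hac, hbc, rfl⟩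
  rcases hcard with h2 | hsf
  · have := Finset.card_le_card hsub
    omega
  · rwa [Finset.eq_of_subset_of_card_le hsub (by rw [(hf s hsf).card_eq, h3])]

theorem mem_complexRealization_of_mem_faces {s : Finset V} (hs : s ∈ faces) {z : V → ℝ}
    (hz : z ∈ stdSimplex ℝ V) (h : ∀ c, z c ≠ 0 → c ∈ s) : z ∈ complexRealization G faces :=
  .inr (.inr ⟨s, hs, hz, fun c => not_imp_comm.mp (h c)⟩)

theorem mem_complexRealization_of_adj {a b : V} (hab : G.Adj a b) {z : V → ℝ}
    (hz : z ∈ stdSimplex ℝ V) (h : ∀ c, z c ≠ 0 → c = a ∨ c = b) : z ∈ complexRealization G faces :=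
  .inr (.inl ⟨a, b, hab, hz, fun c => not_imp_comm.mp fun hc => by simpa using h c hc⟩)

theorem single_mem_complexRealization (a : V) : Pi.single a 1 ∈ complexRealization G faces :=
  .inl ⟨a, single_mem_stdSimplex ℝ a, fun c hc => Pi.single_eq_of_ne (by simpa using hc) _⟩

/-- A complex contains the segments from its points to the vertices of their carriers. -/
theorem segment_single_subset_complexRealization {z : V → ℝ}
    (hz : z ∈ complexRealization G faces) {a : V} (ha : z a ≠ 0) :
    segment ℝ z (Pi.single a 1) ⊆ complexRealization G faces := by
  have key : ∀ s : Finset V, z ∈ closedSimplex s →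
      segment ℝ z (Pi.single a 1) ⊆ closedSimplex s := by
    rintro s ⟨h1, h2⟩ y hy
    refine ⟨(convex_stdSimplex ℝ V).segment_subset h1 (single_mem_stdSimplex ℝ a) hy, ?_⟩
    obtain ⟨p, q, -, -, -, rfl⟩ := hy
    intro c hc
    have hca : c ≠ a := by rintro rfl; exact ha (h2 _ hc)
    simp [h2 c hc, hca]
  rcases hz with ⟨a, h⟩ | ⟨a, b, hab, h⟩ | ⟨s, hs, h⟩
  · exact fun y hy => .inl ⟨a, key _ h hy⟩
  · exact fun y hy => .inr (.inl ⟨a, b, hab, key _ h hy⟩)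
  · exact fun y hy => .inr (.inr ⟨s, hs, key _ h hy⟩)

variable (hf : ∀ s ∈ faces, G.IsNClique 3 s)
  (hK : ∀ x : complexRealization G faces,
    ∃ E : OpenPartialHomeomorph (complexRealization G faces) ℂ, x ∈ E.source)

/-- The midpoint of the edge `va`. -/
noncomputable def edgeMidpoint (v a : V) : V → ℝ := Pi.single v (1 / 2) + Pi.single a (1 / 2)

theorem edgeMidpoint_mem_complexRealization {v a : V} (h : G.Adj v a) :
    edgeMidpoint v a ∈ complexRealization G faces := by
  refine mem_complexRealization_of_adj h ⟨fun c => ?_, ?_⟩ fun c hc => ?_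
  · simp only [edgeMidpoint, Pi.add_apply, Pi.single_apply]
    positivity
  · simp [edgeMidpoint, Finset.sum_add_distrib]
    norm_num
  · by_contra! hne
    simp [edgeMidpoint, hne.1, hne.2] at hc

include hf hK in
/-- An edge of a triangulated surface is on two faces. -/
theorem exists_ne_mem_faces_of_planar {v a : V} (h : G.Adj v a) (b : V) :
    ∃ b', b' ≠ b ∧ {v, a, b'} ∈ faces := by
  by_contra! hb
  have hne := h.ne
  -- Position along the edge, and the mass off it. If `b` alone can carry that mass, `ψ` is
  -- injective near the midpoint, but its image lies in the closed upper half plane and is no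
  -- neighborhood of 0.
  let ψ : (V → ℝ) → ℂ := fun z => (z v - z a : ℝ) + (1 - z v - z a : ℝ) * Complex.I
  have hψre : ∀ z, (ψ z).re = z v - z a := fun z => by simp [ψ]
  have hψim : ∀ z, (ψ z).im = 1 - z v - z a := fun z => by simp [ψ]
  let N : Set (V → ℝ) := {z | 0 < z v} ∩ {z | 0 < z a}
  have hN : N ∈ 𝓝 (edgeMidpoint v a) := by
    refine IsOpen.mem_nhds (.inter (isOpen_lt (by fun_prop) (by fun_prop))
      (isOpen_lt (by fun_prop) (by fun_prop))) ⟨?_, ?_⟩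
    · simp [edgeMidpoint, hne]
    · simp [edgeMidpoint, hne.symm]
  have hval : ∀ z ∈ N ∩ complexRealization G faces, ∀ c, c ≠ v → c ≠ a →
      z c = if c = b then 1 - z v - z a else 0 := by
    rintro z ⟨⟨hv, ha⟩, hz⟩
    have hzero : ∀ c, c ≠ v → c ≠ a → c ≠ b → z c = 0 := by
      intro c hcv hca hcb
      by_contra hc
      exact hb c hcb (mem_faces_of_mem_complexRealization hf hz hne hcv.symm hca.symm
        hv.ne' ha.ne' hc)
    intro c hcv hca
    split_ifs with hcb
    · subst hcb
      have hsum := (exists_clique_of_mem_complexRealization hf hz).1.2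
      rw [← Finset.sum_subset (Finset.subset_univ {v, a, c}) fun d _ hd => by
        simp only [Finset.mem_insert, Finset.mem_singleton, not_or] at hd
        exact hzero d hd.1 hd.2.1 hd.2.2,
        Finset.sum_insert (by simp [hne, hcv.symm]), Finset.sum_insert (by simp [hca.symm]),
        Finset.sum_singleton] at hsum
      linarith
    · exact hzero c hcv hca hcb
  have key := image_inter_mem_nhds_of_planar hK (ψ := ψ)
    (edgeMidpoint_mem_complexRealization h) hN
    (by fun_prop) (by
      intro z hz w hw e
      have e1 := congrArg Complex.re e
      have e2 := congrArg Complex.im e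
      rw [hψre, hψre] at e1
      rw [hψim, hψim] at e2
      have e3 : z v = w v := by linarith
      have e4 : z a = w a := by linarith
      funext c
      by_cases hcv : c = v
      · rw [hcv, e3]
      by_cases hca : c = a
      · rw [hca, e4]
      rw [hval z hz c hcv hca, hval w hw c hcv hca, e3, e4])
  have h0 : ψ (edgeMidpoint v a) = 0 := by
    apply Complex.ext
    · rw [hψre]; simp [edgeMidpoint, hne, hne.symm]
    · rw [hψim]; simp [edgeMidpoint, hne, hne.symm]; norm_num
  rw [h0] at key
  obtain ⟨ε, hε, hball⟩ := Metric.mem_nhds_iff.mp key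
  have hmem : (-(ε / 2) : ℝ) * Complex.I ∈ Metric.ball (0 : ℂ) ε := by
    simp [abs_of_pos hε]
    linarith
  obtain ⟨z, ⟨-, hz⟩, e⟩ := hball hmem
  have him := congrArg Complex.im e
  rw [hψim] at him
  simp at him
  have hstd := (exists_clique_of_mem_complexRealization hf hz).1
  have hle : z v + z a ≤ 1 := by
    rw [← hstd.2, ← Finset.sum_pair hne]
    exact Finset.sum_le_univ_sum_of_nonneg hstd.1
  linarith

include hf hK in
/-- An edge of a triangulated surface is on no more than two faces. -/
theorem eq_or_eq_of_mem_faces_of_planar {v a b₁ b₂ b₃ : V} (h : G.Adj v a) (h1 : {v, a, b₁} ∈ faces)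
    (h2 : {v, a, b₂} ∈ faces) (h3 : {v, a, b₃} ∈ faces) (h12 : b₁ ≠ b₂) : b₃ = b₁ ∨ b₃ = b₂ := by
  by_contra! hne
  obtain ⟨h31, h32⟩ := hne
  have hva := h.ne
  have hdist : ∀ b, {v, a, b} ∈ faces → b ≠ v ∧ b ≠ a := by
    intro b hb
    have := (hf _ hb).card_eq
    constructor
    · rintro rfl
      have : ({b, a, b} : Finset V).card ≤ 2 := by
        rw [Finset.insert_eq_of_mem (by simp)]; exact Finset.card_le_two
      omega
    · rintro rfl
      have : ({v, b, b} : Finset V).card ≤ 2 := by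
        rw [Finset.pair_eq_singleton]; exact Finset.card_le_two
      omega
  obtain ⟨h1v, h1a⟩ := hdist _ h1
  obtain ⟨h2v, h2a⟩ := hdist _ h2
  obtain ⟨h3v, h3a⟩ := hdist _ h3
  -- Unfolds the two faces into the upper and lower half planes, with the real axis along the edge.
  -- On the disk of radius `1/4` the coordinates at `v` and `a` stay positive.
  let φ : ℂ → V → ℝ := fun w => Pi.single v (1 / 2 + w.re - |w.im| / 2) +
    Pi.single a (1 / 2 - w.re - |w.im| / 2) + Pi.single b₁ (max w.im 0) +
    Pi.single b₂ (max (-w.im) 0)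
  have hφ0 : φ 0 = edgeMidpoint v a := by simp [φ, edgeMidpoint]
  have hφv : ∀ w, φ w v = 1 / 2 + w.re - |w.im| / 2 := fun w => by
    simp [φ, hva, h1v.symm, h2v.symm]
  have hφ1 : ∀ w, φ w b₁ = max w.im 0 := fun w => by simp [φ, h1v, h1a, h12]
  have hφ2 : ∀ w, φ w b₂ = max (-w.im) 0 := fun w => by simp [φ, h2v, h2a, h12.symm]
  have hcont : Continuous φ := by
    refine continuous_pi fun c => ?_
    simp only [φ, Pi.add_apply, Pi.single_apply]
    refine ((Continuous.add ?_ ?_).add ?_).add ?_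
    all_goals split_ifs <;> fun_prop
  have hmaps : Set.MapsTo φ (Metric.ball 0 (1 / 4)) (complexRealization G faces) := by
    intro w hw
    have hw' : ‖w‖ < 1 / 4 := by simpa using hw
    have hre := abs_lt.mp ((Complex.abs_re_le_norm w).trans_lt hw')
    have him := (Complex.abs_im_le_norm w).trans_lt hw'
    have hstd : φ w ∈ stdSimplex ℝ V := by
      constructor
      · intro c
        have p1 : 0 ≤ 1 / 2 + w.re - |w.im| / 2 := by linarith [hre.1]
        have p2 : 0 ≤ 1 / 2 - w.re - |w.im| / 2 := by linarith [hre.2]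
        simp only [φ, Pi.add_apply, Pi.single_apply]
        refine add_nonneg (add_nonneg (add_nonneg ?_ ?_) ?_) ?_ <;> split_ifs <;>
          simp only [le_refl, p1, p2, le_max_right]
      · simp only [φ, Pi.add_apply, Finset.sum_add_distrib, Finset.sum_pi_single', Finset.mem_univ,
          if_true]
        rcases le_total 0 w.im with hs | hs
        · rw [abs_of_nonneg hs, max_eq_left hs, max_eq_right (by linarith)]; ring
        · rw [abs_of_nonpos hs, max_eq_right hs, max_eq_left (by linarith)]; ring
    rcases le_total 0 w.im with hs | hs
    · refine mem_complexRealization_of_mem_faces h1 hstd fun c hc => ?_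
      by_contra hn
      simp only [Finset.mem_insert, Finset.mem_singleton, not_or] at hn
      simp [φ, hn.1, hn.2.1, hn.2.2, Pi.single_apply, hs] at hc
    · refine mem_complexRealization_of_mem_faces h2 hstd fun c hc => ?_
      by_contra hn
      simp only [Finset.mem_insert, Finset.mem_singleton, not_or] at hn
      simp [φ, hn.1, hn.2.1, hn.2.2, hs] at hc
  have hinj : Function.Injective φ := by
    intro w w' e
    have e1 := congrFun e b₁
    have e2 := congrFun e b₂
    have e3 := congrFun e v
    rw [hφ1, hφ1] at e1
    rw [hφ2, hφ2] at e2
    rw [hφv, hφv] at e3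
    have him : w.im = w'.im := by
      rw [← max_zero_sub_max_neg_zero_eq_self w.im, ← max_zero_sub_max_neg_zero_eq_self w'.im]
      rw [max_comm w.im, max_comm w'.im] at *
      linarith
    rw [him] at e3
    exact Complex.ext (by linarith) him
  have key := image_mem_nhdsWithin_of_planar hK (Metric.ball_mem_nhds (0 : ℂ) (by norm_num)) hmaps
    hcont.continuousOn hinj.injOn
  -- A path into the third face: it tends to the midpoint, but its `b₃` coordinate is nonzero,
  -- unlike that of any `φ w`.
  let γ : ℝ → V → ℝ := fun t => Pi.single v (1 / 2 - t / 2) + Pi.single a (1 / 2 - t / 2) +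
    Pi.single b₃ t
  have hγ : Filter.Tendsto γ (𝓝[>] 0) (𝓝[complexRealization G faces] φ 0) := by
    refine tendsto_nhdsWithin_iff.mpr ⟨?_, ?_⟩
    · have hc : Continuous γ := by
        refine continuous_pi fun c => ?_
        simp only [γ, Pi.add_apply, Pi.single_apply]
        refine (Continuous.add ?_ ?_).add ?_
        all_goals split_ifs <;> fun_prop
      have := hc.tendsto 0
      rw [show γ 0 = φ 0 by simp [hφ0, γ, edgeMidpoint]] at this
      exact this.mono_left nhdsWithin_le_nhds
    · filter_upwards [Ioo_mem_nhdsGT (show (0 : ℝ) < 1 by norm_num)] with t ht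
      refine mem_complexRealization_of_mem_faces h3 ⟨fun c => ?_, ?_⟩ fun c hc => ?_
      · have p1 : 0 ≤ 1 / 2 - t / 2 := by linarith [ht.2]
        have p2 := ht.1.le
        simp only [γ, Pi.add_apply, Pi.single_apply]
        refine add_nonneg (add_nonneg ?_ ?_) ?_ <;> split_ifs <;> simp only [le_refl, p1, p2]
      · simp only [γ, Pi.add_apply, Finset.sum_add_distrib, Finset.sum_pi_single', Finset.mem_univ,
          if_true]
        ring
      · by_contra hn
        simp only [Finset.mem_insert, Finset.mem_singleton, not_or] at hn
        simp [γ, hn.1, hn.2.1, hn.2.2] at hc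
  obtain ⟨t, ht, ht0⟩ := ((hγ.eventually_mem key).and self_mem_nhdsWithin).exists
  obtain ⟨w, -, e⟩ := ht
  have := congrFun e b₃
  simp [φ, γ, h31, h32, h3v, h3a] at this
  exact (ne_of_gt ht0) this.symm

include hf hK in
/-- A vertex of a triangulated surface has a neighbor. -/
theorem exists_adj_of_planar (v : V) : ∃ a, G.Adj v a := by
  have hopen : IsOpen {z : V → ℝ | 0 < z v} := isOpen_lt (by fun_prop) (by fun_prop)
  obtain ⟨W, hW, hsub, hcon⟩ := exists_mem_nhdsWithin_isConnected_diff_singleton hK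
    (single_mem_complexRealization v) (hopen.mem_nhds (by simp))
  obtain ⟨z, hz, hzv⟩ := hcon.nonempty
  by_contra! hno
  refine hzv ?_
  have hz0 : ∀ c, c ≠ v → z c = 0 := fun c hc => by
    by_contra h
    exact hno c (adj_of_mem_complexRealization hf (hsub hz).2 hc.symm (hsub hz).1.ne' h)
  have hsum := (exists_clique_of_mem_complexRealization hf (hsub hz).2).1.2
  rw [Finset.sum_eq_single v (fun c _ hc => hz0 c hc) (by simp)] at hsum
  funext c
  by_cases hc : c = v
  · subst hc; simpa using hsum
  · simp [hz0 c hc, hc]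

include hf hK in
/-- A set of neighbors of `v` that is closed under adjacency in the link of `v` is the set of all
neighbors. -/
theorem mem_of_adj_of_planar {v : V} {A : Set V} (hA : ∀ c ∈ A, G.Adj v c) (hne : A.Nonempty)
    (hcl : ∀ c ∈ A, ∀ d, c ≠ d → {v, c, d} ∈ faces → d ∈ A) {b : V} (hb : G.Adj v b) : b ∈ A := by
  by_contra hbA
  have hopen : IsOpen {z : V → ℝ | 0 < z v} := isOpen_lt (by fun_prop) (by fun_prop)
  obtain ⟨W, hW, hsub, hcon⟩ := exists_mem_nhdsWithin_isConnected_diff_singleton hK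
    (single_mem_complexRealization v) (hopen.mem_nhds (by simp))
  have hO : ∀ B : Set V, IsOpen {z : V → ℝ | ∃ c ∈ B, 0 < z c} := by
    intro B
    have : {z : V → ℝ | ∃ c ∈ B, 0 < z c} = ⋃ c ∈ B, {z : V → ℝ | 0 < z c} := by ext; simp
    rw [this]
    exact isOpen_biUnion fun c _ => isOpen_lt (by fun_prop) (by fun_prop)
  have hmeet : ∀ B : Set V, ∀ c ∈ B, G.Adj v c →
      ((W \ {Pi.single v 1}) ∩ {z : V → ℝ | ∃ c ∈ B, 0 < z c}).Nonempty := by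
    intro B c hcB hvc
    let γ : ℝ → V → ℝ := fun t => Pi.single v (1 - t) + Pi.single c t
    have hγ : Filter.Tendsto γ (𝓝[>] 0) (𝓝[complexRealization G faces] (Pi.single v 1)) := by
      refine tendsto_nhdsWithin_iff.mpr ⟨?_, ?_⟩
      · have hc : Continuous γ := by
          refine continuous_pi fun c => ?_
          simp only [γ, Pi.add_apply, Pi.single_apply]
          refine Continuous.add ?_ ?_
          all_goals split_ifs <;> fun_prop
        have := hc.tendsto 0
        rw [show γ 0 = Pi.single v 1 by simp [γ]] at this
        exact this.mono_left nhdsWithin_le_nhds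
      · filter_upwards [Ioo_mem_nhdsGT (show (0 : ℝ) < 1 by norm_num)] with t ht
        refine mem_complexRealization_of_adj hvc ⟨fun d => ?_, ?_⟩ fun d hd => ?_
        · have p1 : 0 ≤ 1 - t := by linarith [ht.2]
          have p2 := ht.1.le
          simp only [γ, Pi.add_apply, Pi.single_apply]
          refine add_nonneg ?_ ?_ <;> split_ifs <;> simp only [le_refl, p1, p2]
        · simp only [γ, Pi.add_apply, Finset.sum_add_distrib, Finset.sum_pi_single',
            Finset.mem_univ, if_true]
          ring
        · by_contra! hn
          simp [γ, hn.1, hn.2] at hd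
    obtain ⟨t, ht, ht0⟩ := ((hγ.eventually_mem hW).and self_mem_nhdsWithin).exists
    have htc : γ t c = t := by simp [γ, hvc.ne']
    refine ⟨γ t, ⟨ht, fun h => ?_⟩, c, hcB, by rw [htc]; exact ht0⟩
    rw [Set.mem_singleton_iff.mp h] at htc
    simp [hvc.ne'] at htc
    exact (ne_of_gt ht0) htc.symm
  obtain ⟨a, ha⟩ := hne
  -- The punctured neighborhood of `v` is connected and covered by two open sets: positive at some
  -- vertex of `A`, positive at some neighbor outside `A`. A common point lies in a face `vcd`
  -- leaving `A`.
  obtain ⟨z, ⟨hzW, -⟩, ⟨c, hcA, hzc⟩, d, ⟨hvd, hdA⟩, hzd⟩ := hcon.isPreconnected _ _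
    (hO A) (hO {d | G.Adj v d ∧ d ∉ A}) (by
      rintro z ⟨hzW, hzv⟩
      have hz := (hsub hzW).2
      have hstd := (exists_clique_of_mem_complexRealization hf hz).1
      have : ∃ c, c ≠ v ∧ z c ≠ 0 := by
        by_contra! hz0
        refine hzv ?_
        have hsum := hstd.2
        rw [Finset.sum_eq_single v (fun c _ hc => hz0 c hc) (by simp)] at hsum
        funext c
        by_cases hc : c = v
        · subst hc; simpa using hsum
        · simp [hz0 c hc, hc]
      obtain ⟨c, hcv, hc⟩ := this
      have hpos : 0 < z c := lt_of_le_of_ne (hstd.1 c) hc.symm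
      by_cases hcA : c ∈ A
      · exact .inl ⟨c, hcA, hpos⟩
      · exact .inr ⟨c, ⟨adj_of_mem_complexRealization hf hz hcv.symm (hsub hzW).1.ne' hc, hcA⟩,
          hpos⟩)
    (hmeet A a ha (hA a ha)) (hmeet _ b ⟨hb, hbA⟩ hb)
  have hcd : c ≠ d := by rintro rfl; exact hdA hcA
  exact hdA (hcl c hcA d hcd (mem_faces_of_mem_complexRealization hf (hsub hzW).2 (hA c hcA).ne
    (hvd : G.Adj v d).ne hcd (hsub hzW).1.ne' hzc.ne' hzd.ne'))

end Realization

theorem Finset.exists_eq_triple_of_card_eq_three {V : Type*} [DecidableEq V] {s : Finset V}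
    (hs : s.card = 3) {a b : V} (ha : a ∈ s) (hb : b ∈ s) (hab : a ≠ b) : ∃ c, s = {a, b, c} := by
  have hsub : {a, b} ⊆ s := by simp [Finset.insert_subset_iff, ha, hb]
  have h1 : (s \ {a, b}).card = 1 := by
    rw [Finset.card_sdiff_of_subset hsub, hs, Finset.card_pair hab]
  obtain ⟨c, hc⟩ := Finset.card_eq_one.mp h1
  refine ⟨c, ?_⟩
  rw [← Finset.union_sdiff_of_subset hsub, hc]
  ext x
  simp

namespace SurfaceTriangulation

variable {S V : Type*} [TopologicalSpace S] [Fintype V] [DecidableEq V]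

/-! ### The link cycle and its chords -/

section Link

theorem adj_of_link_adj (T : SurfaceTriangulation S V) {v a b : V}
    (h : (T.link v).Adj a b) : T.G.Adj v a ∧ T.G.Adj v b ∧ T.G.Adj a b :=
  SimpleGraph.is3Clique_triple_iff.mp (T.isNClique_of_mem_faces _ h.2)

theorem link_adj_of_mem_faces (T : SurfaceTriangulation S V) {v a b : V}
    (h : {v, a, b} ∈ T.faces) : (T.link v).Adj a b :=
  ⟨(SimpleGraph.is3Clique_triple_iff.mp (T.isNClique_of_mem_faces _ h)).2.2.ne, h⟩

variable [ChartedSpace (EuclideanSpace ℝ (Fin 2)) S] (T : SurfaceTriangulation S V)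

theorem exists_openPartialHomeomorph (x : complexRealization T.G T.faces) :
    ∃ E : OpenPartialHomeomorph (complexRealization T.G T.faces) ℂ, x ∈ E.source := by
  let e := chartAt (EuclideanSpace ℝ (Fin 2)) (T.homeo x)
  let ι : EuclideanSpace ℝ (Fin 2) ≃ₜ ℂ := Complex.orthonormalBasisOneI.repr.symm.toHomeomorph
  refine ⟨(T.homeo.toOpenPartialHomeomorph.trans e).trans ι.toOpenPartialHomeomorph, ?_⟩
  simp [e]

theorem mem_support_link_iff {v a : V} : a ∈ (T.link v).support ↔ T.G.Adj v a := by
  constructor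
  · rintro ⟨b, h⟩
    exact (T.adj_of_link_adj h).1
  · intro h
    -- The excluded vertex is irrelevant here; `v` is a dummy.
    obtain ⟨b, -, hb⟩ := exists_ne_mem_faces_of_planar T.isNClique_of_mem_faces
      T.exists_openPartialHomeomorph h v
    exact ⟨b, T.link_adj_of_mem_faces hb⟩

/-- Neighbors of `a` in the link correspond to faces on the edge `va`, of which there are exactly
two. -/
theorem isCycles_link (v : V) : (T.link v).IsCycles := by
  rintro a ⟨b, hb⟩
  have hva := (T.adj_of_link_adj hb).1
  obtain ⟨c, hcb, hc⟩ := exists_ne_mem_faces_of_planar T.isNClique_of_mem_faces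
      T.exists_openPartialHomeomorph hva b
  refine Set.ncard_eq_two.mpr ⟨b, c, hcb.symm, Set.ext fun d => ⟨fun hd => ?_, ?_⟩⟩
  · exact eq_or_eq_of_mem_faces_of_planar T.isNClique_of_mem_faces
      T.exists_openPartialHomeomorph hva hb.2 hc hd.2 hcb.symm
  · rintro (rfl | rfl)
    · exact hb
    · exact T.link_adj_of_mem_faces hc

theorem reachable_link {v a b : V} (ha : T.G.Adj v a) (hb : T.G.Adj v b) :
    (T.link v).Reachable a b := by
  have := mem_of_adj_of_planar T.isNClique_of_mem_faces T.exists_openPartialHomeomorph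
    (A := {c | T.G.Adj v c ∧ (T.link v).Reachable a c}) (fun c hc => hc.1)
    ⟨a, ha, .refl a⟩ (fun c hc d hcd hf => by
      have hadj : (T.link v).Adj c d := ⟨hcd, hf⟩
      exact ⟨(T.adj_of_link_adj hadj).2.1, hc.2.trans hadj.reachable⟩) hb
  exact this.2

/-- The link of a vertex is a cycle through all its neighbors. -/
theorem exists_isCycle_link {v a : V} (ha : T.G.Adj v a) :
    ∃ p : (T.link v).Walk a a, p.IsCycle ∧ ∀ w, w ∈ p.support ↔ T.G.Adj v w := by
  obtain ⟨p, hp, h⟩ := (T.isCycles_link v).exists_isCycle_forall_mem_support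
    (fun a b ha hb => T.reachable_link (T.mem_support_link_iff.mp ha)
      (T.mem_support_link_iff.mp hb)) (T.mem_support_link_iff.mpr ha)
  refine ⟨p, hp, fun w => ⟨fun hw => ?_, fun hw => h w (T.mem_support_link_iff.mpr hw)⟩⟩
  obtain ⟨q⟩ : (T.link v).Reachable w a := ⟨(p.takeUntil w hw).reverse⟩
  cases q with
  | nil => exact ha
  | cons h _ => exact (T.adj_of_link_adj h).1

/-- In an irreducible triangulation every edge is on a 3-cycle that bounds no face. -/
theorem Irreducible.exists_adj_not_link_adj {T : SurfaceTriangulation S V} (hT : T.Irreducible)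
    {v a : V} (ha : T.G.Adj v a) : ∃ b, T.G.Adj v b ∧ T.G.Adj a b ∧ ¬ (T.link v).Adj a b := by
  by_contra! hno
  refine hT v a ha ⟨ha, ?_, ?_⟩
  · have h2 := T.isCycles_link v (T.mem_support_link_iff.mpr ha)
    rw [← h2]
    refine (Set.ncard_congr (fun b _ => {v, a, b}) ?_ ?_ ?_).symm
    · intro b hb
      exact ⟨T.isNClique_of_mem_faces _ hb.2, by simp, by simp⟩
    · intro b c hb hc e
      have hb' := T.adj_of_link_adj hb
      have : b ∈ ({v, a, c} : Finset V) := e ▸ (by simp)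
      simpa [hb'.2.1.ne', hb'.2.2.ne'] using this
    · rintro s ⟨hs, hvs, has⟩
      obtain ⟨b, hb⟩ := Finset.exists_eq_triple_of_card_eq_three hs.card_eq hvs has ha.ne
      subst hb
      have := SimpleGraph.is3Clique_triple_iff.mp hs
      exact ⟨b, hno b this.2.1 this.2.2, rfl⟩
  · intro s hs hvs has
    obtain ⟨b, hb⟩ := Finset.exists_eq_triple_of_card_eq_three hs.card_eq hvs has ha.ne
    subst hb
    have := SimpleGraph.is3Clique_triple_iff.mp hs
    exact (hno b this.2.1 this.2.2).2

end Link

/-! ### Nonseparating 3-cycles -/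

/-- The graph of a triangulation of a connected surface is connected. -/
theorem mem_of_forall_adj_mem [ConnectedSpace S] (T : SurfaceTriangulation S V) {A : Set V} {a : V}
    (ha : a ∈ A) (hA : ∀ b ∈ A, ∀ c, T.G.Adj b c → c ∈ A) (w : V) : w ∈ A := by
  by_contra hw
  have hcon : IsConnected (complexRealization T.G T.faces) :=
    isConnected_iff_connectedSpace.mpr (T.homeo.symm.surjective.connectedSpace T.homeo.symm.continuous)
  -- Points supported off `A` and points supported in `A` form two closed sets. They cover the
  -- complex when no edge leaves `A`, and a common point would have coordinate sum 0.
  have hcl : ∀ B : Set V, IsClosed {z : V → ℝ | ∀ c ∈ B, z c = 0} := by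
    intro B
    simp only [Set.ofPred_forall]
    exact isClosed_biInter fun c _ => isClosed_eq (by fun_prop) (by fun_prop)
  obtain ⟨z, hz, h1, h2⟩ := isPreconnected_closed_iff.mp hcon.isPreconnected _ _ (hcl A) (hcl Aᶜ)
    (fun z hz => by
      by_contra hno
      simp only [Set.mem_union, Set.mem_ofPred_eq, not_or, not_forall] at hno
      obtain ⟨⟨b, hb, hzb⟩, c, hc, hzc⟩ := hno
      exact hc (hA b hb c (adj_of_mem_complexRealization T.isNClique_of_mem_faces hz
        (by rintro rfl; exact hc hb) hzb hzc)))
    ⟨_, single_mem_complexRealization w, fun c hc =>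
      Pi.single_eq_of_ne (by rintro rfl; exact hw hc) _⟩
    ⟨_, single_mem_complexRealization a, fun c hc =>
      Pi.single_eq_of_ne (by rintro rfl; exact hc ha) _⟩
  obtain ⟨⟨-, hsum⟩, -⟩ := exists_clique_of_mem_complexRealization T.isNClique_of_mem_faces hz
  rw [Finset.sum_eq_zero fun c _ => ?_] at hsum
  · exact zero_ne_one hsum
  · by_cases hc : c ∈ A
    · exact h1 c hc
    · exact h2 c hc

/-- A 3-cycle that bounds no face is nonseparating if its deletion leaves the graph connected. -/
theorem isConnected_compl_cycleSet (T : SurfaceTriangulation S V) {v a c x : V}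
    (hface : {v, a, c} ∉ T.faces) (hx : x ∉ ({v, a, c} : Finset V))
    (hva : v ≠ a) (hvc : v ≠ c) (hac : a ≠ c)
    (h : ∀ r : V → V → Prop, Equivalence r →
      (∀ u w, T.G.Adj u w → u ∉ ({v, a, c} : Finset V) → w ∉ ({v, a, c} : Finset V) → r u w) →
      ∀ u w, u ∉ ({v, a, c} : Finset V) → w ∉ ({v, a, c} : Finset V) → r u w) :
    IsConnected (T.cycleSet v a c)ᶜ := by
  set C : Finset V := {v, a, c} with hC
  set K := complexRealization T.G T.faces with hK
  -- This is the complement of the three edges, because `hface` excludes points with support exactly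
  -- `C`. Each point of `F` is joined within `F` to a vertex outside `C`.
  let F : Set (V → ℝ) := {z | z ∈ K ∧ ∃ u ∉ C, z u ≠ 0}
  have hseg : ∀ z ∈ F, ∀ u ∉ C, z u ≠ 0 → segment ℝ z (Pi.single u 1) ⊆ F := by
    intro z hz u hu hzu y hy
    refine ⟨segment_single_subset_complexRealization hz.1 hzu hy, u, hu, ?_⟩
    have hpos : 0 < z u := lt_of_le_of_ne ((exists_clique_of_mem_complexRealization
      T.isNClique_of_mem_faces hz.1).1.1 u) hzu.symm
    obtain ⟨s, t, hs, ht, hst, rfl⟩ := hy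
    have : 0 < s * z u + t := by
      rcases hs.eq_or_lt with rfl | hs
      · linarith
      · have := mul_pos hs hpos
        linarith
    simpa using this.ne'
  have hsingle : ∀ u ∉ C, Pi.single u 1 ∈ F := fun u hu =>
    ⟨single_mem_complexRealization u, u, hu, by simp⟩
  have hcomp : ∀ z ∈ F, ∀ u ∉ C, z u ≠ 0 →
      connectedComponentIn F z = connectedComponentIn F (Pi.single u 1) := by
    intro z hz u hu hzu
    exact connectedComponentIn_eq (((convex_segment z _).isPreconnected.subset_connectedComponentIn
      (left_mem_segment ℝ _ _) (hseg z hz u hu hzu)) (right_mem_segment ℝ _ _))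
  have hedge := h (fun u w => connectedComponentIn F (Pi.single u 1) =
    connectedComponentIn F (Pi.single w 1)) ⟨fun _ => rfl, fun h => h.symm, fun h h' => h.trans h'⟩
    (fun u w huw hu hw => by
      have hm : edgeMidpoint u w ∈ F := ⟨edgeMidpoint_mem_complexRealization huw, u, hu, by
        simp [edgeMidpoint, huw.ne]⟩
      rw [← hcomp _ hm u hu (by simp [edgeMidpoint, huw.ne]),
        ← hcomp _ hm w hw (by simp [edgeMidpoint, huw.ne'])])
  have hF : IsConnected F := by
    refine ⟨⟨_, hsingle x hx⟩, ?_⟩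
    have : F = connectedComponentIn F (Pi.single x 1) := by
      refine Set.Subset.antisymm (fun z hz => ?_) (connectedComponentIn_subset _ _)
      obtain ⟨u, hu, hzu⟩ := hz.2
      rw [hedge x u hx hu, ← hcomp z hz u hu hzu]
      exact mem_connectedComponentIn hz
    rw [this]
    exact isPreconnected_connectedComponentIn
  have hsub : (Subtype.val ⁻¹' F : Set K) = {x : K | x.1 ∈ closedSimplex {v, a} ∪
      closedSimplex {a, c} ∪ closedSimplex {c, v}}ᶜ := by
    ext ⟨z, hz⟩
    have hstd := (exists_clique_of_mem_complexRealization T.isNClique_of_mem_faces hz).1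
    simp only [Set.mem_preimage, Set.mem_compl_iff, Set.mem_ofPred_eq]
    constructor
    · rintro ⟨-, u, hu, hzu⟩ hmem
      simp only [hC, Finset.mem_insert, Finset.mem_singleton, not_or] at hu
      rcases hmem with (hm | hm) | hm
      all_goals exact hzu (hm.2 u (by simp [hu]))
    · intro hmem
      refine ⟨hz, ?_⟩
      by_contra! hno
      have hout : ∀ u, u ≠ v → u ≠ a → u ≠ c → z u = 0 := fun u h1 h2 h3 =>
        hno u (by simp [hC, h1, h2, h3])
      have hzv : z v ≠ 0 := fun h0 => hmem (.inl (.inr ⟨hstd, fun u hu => by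
        simp only [Finset.mem_insert, Finset.mem_singleton, not_or] at hu
        by_cases huv : u = v
        · rw [huv, h0]
        · exact hout u huv hu.1 hu.2⟩))
      have hza : z a ≠ 0 := fun h0 => hmem (.inr ⟨hstd, fun u hu => by
        simp only [Finset.mem_insert, Finset.mem_singleton, not_or] at hu
        by_cases hua : u = a
        · rw [hua, h0]
        · exact hout u hu.2 hua hu.1⟩)
      have hzc : z c ≠ 0 := fun h0 => hmem (.inl (.inl ⟨hstd, fun u hu => by
        simp only [Finset.mem_insert, Finset.mem_singleton, not_or] at hu
        by_cases huc : u = c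
        · rw [huc, h0]
        · exact hout u hu.1 hu.2 huc⟩))
      exact hface (mem_faces_of_mem_complexRealization T.isNClique_of_mem_faces hz hva hvc hac
        hzv hza hzc)
  have hFK : IsConnected (Subtype.val ⁻¹' F : Set K) := by
    have himg : Subtype.val '' (Subtype.val ⁻¹' F : Set K) = F := by
      rw [Subtype.image_preimage_coe]
      exact Set.inter_eq_right.mpr fun z hz => hz.1
    refine ⟨?_, ?_⟩
    · exact ⟨⟨_, (hsingle x hx).1⟩, hsingle x hx⟩
    · rw [← IsInducing.subtypeVal.isPreconnected_image, himg]
      exact hF.isPreconnected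
  rw [hsub] at hFK
  have := hFK.image T.homeo T.homeo.continuous.continuousOn
  rwa [Set.image_compl_eq T.homeo.bijective] at this

/-- A 3-cycle through `v` is nonseparating if another one crosses it at `v`. -/
theorem isNonseparatingThreeCycle_of_crossing [ConnectedSpace S]
    [ChartedSpace (EuclideanSpace ℝ (Fin 2)) S] (T : SurfaceTriangulation S V) {v a : V}
    {p : (T.link v).Walk a a} (hp : p.IsCycle) (hs : ∀ w, w ∈ p.support ↔ T.G.Adj v w)
    {i k j : ℕ} (hi : 0 < i) (hik : i < k) (hkj : k < j) (hj : j < p.length)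
    (hk : T.G.Adj a (p.getVert k)) (hface : ¬ (T.link v).Adj a (p.getVert k))
    (hij : T.G.Adj (p.getVert i) (p.getVert j)) :
    T.IsNonseparatingThreeCycle v a (p.getVert k) := by
  have hva : T.G.Adj v a := (hs a).mp p.start_mem_support
  have hmem : ∀ m, T.G.Adj v (p.getVert m) := fun m => (hs _).mp (p.getVert_mem_support m)
  have hai : p.getVert i ≠ a := by
    simpa using (hp.getVert_ne_getVert hi (by omega)).symm
  have haj : p.getVert j ≠ a := by
    simpa using (hp.getVert_ne_getVert (i := 0) (j := j) (by omega) (by omega)).symm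
  have hki : p.getVert i ≠ p.getVert k := hp.getVert_ne_getVert hik (by omega)
  have hkj' : p.getVert j ≠ p.getVert k := (hp.getVert_ne_getVert hkj hj).symm
  have hvc := hmem k
  have hvi := hmem i
  refine ⟨hva, hk, hvc.symm, ?_⟩
  refine T.isConnected_compl_cycleSet (x := p.getVert i) (fun h => hface ⟨hk.ne, h⟩)
    (by simp [hvi.ne', hai, hki]) hva.ne hvc.ne hk.ne fun r hr hadj => ?_
  have hout : ∀ w, w ∉ ({v, a, p.getVert k} : Finset V) ↔ w ≠ v ∧ w ≠ a ∧ w ≠ p.getVert k := by simp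
  simp only [hout] at hadj ⊢
  -- The two arcs of the link of `v` between `a` and the `k`-th vertex are joined by the edge from
  -- position `i` to position `j`.
  have hnbr : ∀ w, T.G.Adj v w → w ≠ a → w ≠ p.getVert k → r (p.getVert i) w := by
    intro w hw hwa hwk
    refine hp.rel_of_forall_adj_of_rel hr hi hik hkj hj
      (hadj _ _ hij ⟨hvi.ne', hai, hki⟩ ⟨(hmem j).ne', haj, hkj'⟩)
      (fun y z hyz hya hyk hza hzk => ?_) (p.getVert_mem_support i) hai hki ((hs w).mpr hw) hwa hwk
    have hyz' := T.adj_of_link_adj hyz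
    exact hadj _ _ hyz'.2.2 ⟨hyz'.1.ne', hya, hyk⟩ ⟨hyz'.2.1.ne', hza, hzk⟩
  generalize p.getVert i = x at *
  generalize p.getVert k = c at *
  -- the neighbors of an end `e` of the edge `ac` other than `v` and the end `f`
  have hend : ∀ e f, T.G.Adj e f → T.G.Adj v e → v ≠ f →
      (∀ w, w ≠ e → w ≠ f → w ≠ a ∧ w ≠ c) → ∀ w, T.G.Adj e w → w ≠ v → w ≠ f → r x w := by
    intro e f hef hve hvf hC w hew hwv hwf
    obtain ⟨q, hq, hqs⟩ := T.exists_isCycle_link hef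
    -- The path left by deleting `f` from the link of `e` may pass through the deleted vertex `v`.
    -- Letting `x` stand in for `v` is harmless, since `hnbr` relates `x` to the surviving neighbors
    -- of `v`.
    let g : V → V := fun u => if u = v then x else u
    have hg : ∀ u, u ≠ v → g u = u := fun u hu => if_neg hu
    have hgv : g v = x := if_pos rfl
    have key := hq.rel_of_forall_adj_ne (r := fun y z => r (g y) (g z))
      ⟨fun _ => hr.refl _, fun h => hr.symm h, fun h h' => hr.trans h h'⟩
      (fun y z hyz hyf hzf => by
        have hyz' := T.adj_of_link_adj hyz
        have hy := hC y hyz'.1.ne' hyf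
        have hz := hC z hyz'.2.1.ne' hzf
        by_cases hyv : y = v
        · subst hyv
          rw [hgv, hg z hyz'.2.2.ne']
          exact hnbr z hyz'.2.2 hz.1 hz.2
        by_cases hzv : z = v
        · subst hzv
          rw [hgv, hg y hyv]
          exact hr.symm (hnbr y hyz'.2.2.symm hy.1 hy.2)
        rw [hg y hyv, hg z hzv]
        exact hadj y z hyz'.2.2 ⟨hyv, hy⟩ ⟨hzv, hz⟩)
      ((hqs v).mpr hve.symm) hvf ((hqs w).mpr hew) hwf
    rwa [hgv, hg w hwv] at key
  -- The conditions make `v`, `a`, `c` members vacuously, so closure under adjacency must be checked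
  -- at them too: this is `hnbr` and `hend`.
  have hall : ∀ w, w ∈ {w | w ≠ v → w ≠ a → w ≠ c → r x w} := by
    refine T.mem_of_forall_adj_mem (a := x) (fun _ _ _ => hr.refl x) fun b hb d hbd hdv hda hdc => ?_
    by_cases hbv : b = v
    · exact hnbr d (hbv ▸ hbd) hda hdc
    by_cases hba : b = a
    · exact hend a c hk hva hvc.ne (fun w h1 h2 => ⟨h1, h2⟩) d (hba ▸ hbd) hdv hdc
    by_cases hbc : b = c
    · exact hend c a hk.symm hvc hva.ne (fun w h1 h2 => ⟨h2, h1⟩) d (hbc ▸ hbd) hdv hda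
    exact hr.trans (hb hbv hba hbc) (hadj b d hbd ⟨hbv, hba, hbc⟩ ⟨hdv, hda, hdc⟩)
  intro u w hu hw
  exact hr.trans (hr.symm (hall u hu.1 hu.2.1 hu.2.2)) (hall w hw.1 hw.2.1 hw.2.2)

end SurfaceTriangulation

/-! ### The two crossing 3-cycles -/

theorem theorem5 {S V : Type*} [TopologicalSpace S] [T2Space S] [CompactSpace S]
    [ConnectedSpace S] [ChartedSpace (EuclideanSpace ℝ (Fin 2)) S]
    (hS : IsEmpty (S ≃ₜ Metric.sphere (0 : EuclideanSpace ℝ (Fin 3)) 1))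
    [Fintype V] [DecidableEq V] (T : SurfaceTriangulation S V) (hT : T.Irreducible) (v : V) :
    ∃ vi vj vk vl : V, [vi, vj, vk, vl].Nodup ∧
      T.IsNonseparatingThreeCycle v vi vk ∧ T.IsNonseparatingThreeCycle v vj vl ∧
      ∃ p q : (T.link v).Walk vi vk, SurfaceTriangulation.AreTheTwoPaths p q ∧
        vj ∈ p.support ∧ vl ∈ q.support := by
  obtain ⟨a₀, ha₀⟩ := exists_adj_of_planar T.isNClique_of_mem_faces T.exists_openPartialHomeomorph v
  obtain ⟨p₀, hp₀, hs₀⟩ := T.exists_isCycle_link ha₀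
  obtain ⟨a, p, k, m, hp, hsp, hk, hkm, hm, ⟨hak, hak'⟩, h1m, h1m'⟩ :=
    SimpleGraph.exists_isCycle_crossing (H := T.G) p₀ hp₀ (fun x hx => by
      obtain ⟨y, hvy, hxy, h⟩ := hT.exists_adj_not_link_adj ((hs₀ x).mp hx)
      exact ⟨y, (hs₀ y).mpr hvy, hxy, h⟩)
  have hs : ∀ w, w ∈ p.support ↔ T.G.Adj v w := fun w => (hsp w).trans (hs₀ w)
  have hne : ∀ i j, i < j → j < p.length → p.getVert i ≠ p.getVert j :=
    fun i j => hp.getVert_ne_getVert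
  have h0 : p.getVert 0 = a := p.getVert_zero
  refine ⟨a, p.getVert 1, p.getVert k, p.getVert m, ?_, ?_, ?_,
    p.take k, (p.drop k).reverse, ⟨?_, ?_, ?_, ?_⟩, ?_, ?_⟩
  · have n1 := hne 0 1 (by omega) (by omega)
    have n2 := hne 0 k (by omega) (by omega)
    have n3 := hne 0 m (by omega) (by omega)
    rw [h0] at n1 n2 n3
    simp [n1, n2, n3, hne 1 k hk (by omega), hne 1 m (by omega) hm, hne k m hkm hm]
  · exact T.isNonseparatingThreeCycle_of_crossing hp hs one_pos hk hkm hm hak hak' h1m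
  -- The same crossing seen from position 1: the chord now ends at `m - 1`, and the chord crossing
  -- it runs from `k - 1` to the last position, which is `a`.
  · obtain ⟨q, hq, hlen, hgv, hqs⟩ := hp.exists_isCycle_getVert_succ
    have e1 : q.getVert (k - 1) = p.getVert k := by
      rw [hgv _ (by omega), Nat.sub_add_cancel (by omega)]
    have e2 : q.getVert (m - 1) = p.getVert m := by
      rw [hgv _ (by omega), Nat.sub_add_cancel (by omega)]
    have e3 : q.getVert (p.length - 1) = a := by
      rw [hgv _ (by omega), Nat.sub_add_cancel (by omega), p.getVert_length]
    have := T.isNonseparatingThreeCycle_of_crossing hq (fun w => (hqs w).trans (hs w))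
      (i := k - 1) (k := m - 1) (j := p.length - 1) (by omega) (by omega) (by omega) (by omega)
      (by rwa [e2]) (by rwa [e2]) (by rw [e1, e3]; exact hak.symm)
    rwa [e2] at this
  · exact hp.isPath_take (by omega)
  · exact (hp.isPath_drop (by omega)).reverse
  · rw [SimpleGraph.Walk.reverse_reverse, SimpleGraph.Walk.append_take_drop_eq]
    exact hp
  · intro e he
    rw [SimpleGraph.Walk.edges_reverse, List.mem_reverse, ← List.mem_append,
      ← SimpleGraph.Walk.edges_append, SimpleGraph.Walk.append_take_drop_eq]
    induction e with
    | _ x y =>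
      have hxy : (T.link v).Adj x y := he
      exact (T.isCycles_link v).mem_edges_of_isCycle hp
        ((hs x).mpr (T.adj_of_link_adj hxy).1) hxy
  · have := (p.take k).getVert_mem_support 1
    rwa [SimpleGraph.Walk.take_getVert, min_eq_right hk.le] at this
  · rw [SimpleGraph.Walk.support_reverse, List.mem_reverse]
    have := (p.drop k).getVert_mem_support (m - k)
    rwa [SimpleGraph.Walk.drop_getVert, Nat.add_sub_cancel' hkm.le] at this
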